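/- Let $n \ge 5$ and let $G = 2A_n$ be the double cover of the alternating group $A_n$, realised as the full preimage of $A_n$ under the double covering $\mathrm{Spin}(n) \to \mathrm{SO}(n)$, where $A_n$ is embedded in $\mathrm{SO}(n)$ as the group of even permutation matrices. Then $G$ contains a broad subgroup, that is, an elementary abelian $2$-subgroup $E \le G$ such that every involution of $G$ (element of order $2$) is conjugate in $G$ to an element of $E$. -/

import Mathlib

/-- A subgroup `E` of `G` is an elementary abelian `2`-subgroup: it is abelian and each of its
elements squares to `1`. -/
def IsElementaryAbelianTwo {G : Type*} [Group G] (E : Subgroup G) : Prop :=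
  (∀ x ∈ E, ∀ y ∈ E, x * y = y * x) ∧ ∀ x ∈ E, x ^ 2 = 1

/-- A subgroup `E` of `G` is broad: it is an elementary abelian `2`-subgroup, and every involution
(element of order `2`) of `G` is conjugate in `G` to an element of `E`. -/
def IsBroadSubgroup {G : Type*} [Group G] (E : Subgroup G) : Prop :=
  IsElementaryAbelianTwo E ∧ ∀ x : G, orderOf x = 2 → ∃ y ∈ E, IsConj x y

/-- The standard positive definite quadratic form `x₁ ^ 2 + ⋯ + xₙ ^ 2` on `ℝⁿ`. -/
noncomputable def euclideanForm (n : ℕ) : QuadraticForm ℝ (Fin n → ℝ) :=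
  QuadraticMap.weightedSumSquares ℝ (fun _ : Fin n => (1 : ℝ))

/-- The image `eᵢ` of the `i`-th standard basis vector of `ℝⁿ` in the Clifford algebra. -/
noncomputable def cliffordBasis (n : ℕ) (i : Fin n) : CliffordAlgebra (euclideanForm n) :=
  CliffordAlgebra.ι (euclideanForm n) (Pi.single i 1)

/-- The double cover `2Aₙ` of the alternating group `Aₙ`, as the full preimage of `Aₙ` under the
double cover `Spin(n) → SO(n)`, `u ↦ (v ↦ u v u⁻¹)`. Here `Aₙ` lies in `SO(n)` as the group of even
permutation matrices, so that `u ∈ Spin(n)` lies over `σ ∈ Aₙ` if and only if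
`u eᵢ u⁻¹ = e_{σ i}` for all `i`. -/
noncomputable def doubleCoverAlternating (n : ℕ) : Subgroup (spinGroup (euclideanForm n)) where
  carrier := {u | ∃ σ ∈ alternatingGroup (Fin n), ∀ i : Fin n,
    (u : CliffordAlgebra (euclideanForm n)) * cliffordBasis n i *
      ((u⁻¹ : spinGroup (euclideanForm n)) : CliffordAlgebra (euclideanForm n)) =
        cliffordBasis n (σ i)}
  one_mem' := ⟨1, one_mem _, fun i => by simp⟩
  mul_mem' := by
    rintro u v ⟨σ, hσ, hu⟩ ⟨τ, hτ, hv⟩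
    refine ⟨σ * τ, mul_mem hσ hτ, fun i => ?_⟩
    rw [Equiv.Perm.mul_apply, ← hu, ← hv, mul_inv_rev]
    simp only [Submonoid.coe_mul, mul_assoc]
  inv_mem' := by
    rintro u ⟨σ, hσ, hu⟩
    refine ⟨σ⁻¹, inv_mem hσ, fun i => ?_⟩
    have h := hu (σ⁻¹ i)
    rw [← Equiv.Perm.mul_apply, mul_inv_cancel, Equiv.Perm.one_apply] at h
    have h1 : ((u⁻¹ : spinGroup (euclideanForm n)) : CliffordAlgebra (euclideanForm n)) *
        (u : CliffordAlgebra (euclideanForm n)) = 1 := by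
      rw [← Submonoid.coe_mul, inv_mul_cancel, Submonoid.coe_one]
    rw [inv_inv, ← h]
    simp only [mul_assoc, h1, mul_one]
    rw [← mul_assoc, h1, one_mul]

/-! ### Clifford relations and even elements commuting with all vectors -/

open CliffordAlgebra

/-! An involution of `2Aₙ` lies over some even `σ` with `σ ^ 2 = 1`, and such a `σ` is conjugate in
`Aₙ` to a standard product of `m` disjoint transpositions (`exists_even_conj_eq_pairPerm`). That
product lifts to `m` pairwise anticommuting unit vectors multiplied together, whose square is `(-1)
^ m.choose 2` (`pairProd_mul_self`). The kernel of `2Aₙ → Aₙ` is `±1`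
(`LiesOver.eq_one_or_eq_neg_one`), so the conjugated involution is plus or minus this lift. Its
square being `1`, together with `m` even, forces `4 ∣ m`.

Hence `E` can be generated by `-1` and the standard lifts with `m = 4k`. They square to `1`, and
they commute because each is an initial segment, of even length, of the longer ones
(`commute_pairProd`). -/

theorem euclideanForm_apply (n : ℕ) (v : Fin n → ℝ) : euclideanForm n v = ∑ i, v i * v i := by
  simp [euclideanForm, QuadraticMap.weightedSumSquares_apply]

theorem cliffordBasis_mul_self {n : ℕ} (i : Fin n) :
    cliffordBasis n i * cliffordBasis n i = 1 := by
  rw [cliffordBasis, ι_sq_scalar, euclideanForm_apply,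
    Finset.sum_eq_single i (by intro j _ h; simp [h]) (by simp)]
  simp

theorem cliffordBasis_anticomm {n : ℕ} {i j : Fin n} (h : i ≠ j) :
    cliffordBasis n i * cliffordBasis n j = -(cliffordBasis n j * cliffordBasis n i) := by
  refine ι_mul_ι_comm_of_isOrtho ?_
  rw [QuadraticMap.isOrtho_def]
  simp only [euclideanForm_apply, ← Finset.sum_add_distrib]
  refine Finset.sum_congr rfl fun k _ => ?_
  by_cases hk : k = i
  · subst hk; simp [h]
  · simp [hk]

/-- Passing `eᵢ` across a product of other basis vectors costs one sign per factor, which is what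
the grade involution records. -/
theorem cliffordBasis_mul_comm {n : ℕ} (i : Fin n) (x : CliffordAlgebra (euclideanForm n))
    (S : Set (Fin n)) (hi : i ∉ S) (hx : x ∈ Algebra.adjoin ℝ (cliffordBasis n '' S)) :
    x * cliffordBasis n i = cliffordBasis n i * involute x := by
  induction hx using Algebra.adjoin_induction with
  | mem x hx =>
    obtain ⟨j, hj, rfl⟩ := hx
    have : j ≠ i := fun h => hi (h ▸ hj)
    rw [cliffordBasis_anticomm this]
    simp [cliffordBasis]
  | algebraMap r => simp [Algebra.commutes]
  | add x y _ _ hx hy => simp [add_mul, mul_add, hx, hy]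
  | mul x y _ _ hx hy => rw [mul_assoc, hy, ← mul_assoc, hx, map_mul, mul_assoc]

theorem involute_mem_adjoin {n : ℕ} {S : Set (Fin n)} {x : CliffordAlgebra (euclideanForm n)}
    (hx : x ∈ Algebra.adjoin ℝ (cliffordBasis n '' S)) :
    involute x ∈ Algebra.adjoin ℝ (cliffordBasis n '' S) := by
  induction hx using Algebra.adjoin_induction with
  | mem x hx =>
    have : involute x = -x := by
      obtain ⟨j, hj, rfl⟩ := hx
      simp [cliffordBasis]
    rw [this]
    exact neg_mem (Algebra.subset_adjoin hx)
  | algebraMap r => simp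
  | add x y _ _ hx hy => rw [map_add]; exact add_mem hx hy
  | mul x y _ _ hx hy => rw [map_mul]; exact mul_mem hx hy

/-- Twisted commutation moves every `eᵢ` to the left, and `eᵢ² = 1` leaves at most one of them. -/
theorem exists_eq_add_cliffordBasis_mul {n : ℕ} (i : Fin n) {S : Set (Fin n)} (hi : i ∉ S)
    {x : CliffordAlgebra (euclideanForm n)}
    (hx : x ∈ Algebra.adjoin ℝ (cliffordBasis n '' insert i S)) :
    ∃ a ∈ Algebra.adjoin ℝ (cliffordBasis n '' S), ∃ b ∈ Algebra.adjoin ℝ (cliffordBasis n '' S),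
      x = a + cliffordBasis n i * b := by
  induction hx using Algebra.adjoin_induction with
  | mem x hx =>
    obtain ⟨j, rfl | hj, rfl⟩ := hx
    · exact ⟨0, zero_mem _, 1, one_mem _, by simp⟩
    · exact ⟨_, Algebra.subset_adjoin ⟨j, hj, rfl⟩, 0, zero_mem _, by simp⟩
  | algebraMap r => exact ⟨_, algebraMap_mem _ r, 0, zero_mem _, by simp⟩
  | add x y _ _ hx hy =>
    obtain ⟨a, ha, b, hb, rfl⟩ := hx
    obtain ⟨c, hc, d, hd, rfl⟩ := hy
    exact ⟨a + c, add_mem ha hc, b + d, add_mem hb hd, by rw [mul_add]; abel⟩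
  | mul x y _ _ hx hy =>
    obtain ⟨a, ha, b, hb, rfl⟩ := hx
    obtain ⟨c, hc, d, hd, rfl⟩ := hy
    refine ⟨a * c + involute b * d, add_mem (mul_mem ha hc) (mul_mem (involute_mem_adjoin hb) hd),
      involute a * d + b * c, add_mem (mul_mem (involute_mem_adjoin ha) hd) (mul_mem hb hc), ?_⟩
    have h1 := cliffordBasis_mul_comm i a S hi ha
    have h2 := cliffordBasis_mul_comm i b S hi hb
    have h3 : a * (cliffordBasis n i * d) = cliffordBasis n i * (involute a * d) := by
      rw [← mul_assoc, h1, mul_assoc]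
    have h4 : cliffordBasis n i * b * (cliffordBasis n i * d) = involute b * d := by
      rw [mul_assoc, ← mul_assoc b, h2, ← mul_assoc, ← mul_assoc, cliffordBasis_mul_self, one_mul]
    rw [add_mul, mul_add, mul_add, h3, h4, mul_add, mul_assoc]
    abel

theorem adjoin_range_cliffordBasis (n : ℕ) :
    Algebra.adjoin ℝ (Set.range (cliffordBasis n)) = ⊤ := by
  rw [eq_top_iff, ← adjoin_range_ι]
  refine Algebra.adjoin_le ?_
  rintro _ ⟨v, rfl⟩
  rw [pi_eq_sum_univ' v, map_sum]
  refine sum_mem fun i _ => ?_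
  rw [map_smul]
  exact Subalgebra.smul_mem _ (Algebra.subset_adjoin (Set.mem_range_self i)) _

/-- An even element of the Clifford algebra that commutes with all vectors is a scalar. -/
theorem exists_eq_algebraMap_of_commute {n : ℕ} {x : CliffordAlgebra (euclideanForm n)}
    (hx : involute x = x) (hc : ∀ i, x * cliffordBasis n i = cliffordBasis n i * x) :
    ∃ r : ℝ, x = algebraMap ℝ _ r := by
  -- Basis vectors are eliminated one at a time; once all are gone only scalars remain.
  have key : ∀ T : Finset (Fin n),
      x ∈ Algebra.adjoin ℝ (cliffordBasis n '' (↑T : Set (Fin n))ᶜ) := by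
    intro T
    induction T using Finset.induction_on with
    | empty => simp [adjoin_range_cliffordBasis]
    | insert i T hi ih =>
      have hS : ((↑T : Set (Fin n))ᶜ) = insert i (↑(insert i T) : Set (Fin n))ᶜ := by
        ext j
        by_cases h : j = i
        · subst h; simp [hi]
        · simp [h]
      have hi' : i ∉ (↑(insert i T) : Set (Fin n))ᶜ := by simp
      rw [hS] at ih
      obtain ⟨a, ha, b, hb, hab⟩ := exists_eq_add_cliffordBasis_mul i hi' ih
      have h1 := cliffordBasis_mul_comm i a _ hi' ha
      have h2 := cliffordBasis_mul_comm i b _ hi' hb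
      set e := cliffordBasis n i with he
      have hee : e * e = 1 := cliffordBasis_mul_self i
      -- Evenness gives one sign on the `e` term and conjugation by `e` gives the other, so adding
      -- the two expressions cancels that term.
      have hx1 : x = involute a - e * involute b := by
        rw [← hx, hab, map_add, map_mul, he]
        simp [cliffordBasis, sub_eq_add_neg]
      have hx2 : x = involute a + e * involute b := by
        calc x = e * (x * e) := by rw [hc i, ← mul_assoc, hee, one_mul]
          _ = _ := by
            rw [hab, add_mul, h1, mul_assoc, h2, ← mul_assoc e e, hee, one_mul, mul_add,
              ← mul_assoc, hee, one_mul]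
      have h2x : (2 : ℝ) • x = (2 : ℝ) • involute a := by
        rw [two_smul, two_smul]
        nth_rw 1 [hx1]
        rw [hx2]
        abel
      rw [smul_right_injective _ (two_ne_zero' ℝ) h2x]
      exact involute_mem_adjoin ha
  have h := key Finset.univ
  simp only [Finset.coe_univ, Set.compl_univ, Set.image_empty, Algebra.adjoin_empty] at h
  obtain ⟨r, hr⟩ := Algebra.mem_bot.1 h
  exact ⟨r, hr.symm⟩

instance (n : ℕ) : Nontrivial (CliffordAlgebra (euclideanForm n)) :=
  haveI : Invertible (2 : ℝ) := invertibleOfNonzero two_ne_zero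
  inferInstance

/-! ### Lifting permutations to products of unit vectors -/

/-- The vector `(e_a - e_b) / √2` in the Clifford algebra; it lies over the transposition
`(a b)`. -/
noncomputable def swapVector (n : ℕ) (a b : Fin n) : CliffordAlgebra (euclideanForm n) :=
  (√2 : ℝ)⁻¹ • (cliffordBasis n a - cliffordBasis n b)

theorem swapVector_mem_range_ι {n : ℕ} (a b : Fin n) :
    swapVector n a b ∈ LinearMap.range (ι (euclideanForm n)) :=
  ⟨(√2 : ℝ)⁻¹ • (Pi.single a 1 - Pi.single b 1), by simp [swapVector, cliffordBasis]⟩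

theorem swapVector_mul_self {n : ℕ} {a b : Fin n} (h : a ≠ b) :
    swapVector n a b * swapVector n a b = 1 := by
  have h2 : (√2 : ℝ)⁻¹ * (√2 : ℝ)⁻¹ * 2 = 1 := by
    rw [← mul_inv, Real.mul_self_sqrt (by norm_num)]; norm_num
  have : (cliffordBasis n a - cliffordBasis n b) * (cliffordBasis n a - cliffordBasis n b) =
      (2 : ℝ) • 1 := by
    rw [sub_mul, mul_sub, mul_sub, cliffordBasis_mul_self, cliffordBasis_mul_self,
      cliffordBasis_anticomm h, two_smul]
    abel
  rw [swapVector, smul_mul_smul_comm, this, smul_smul, h2, one_smul]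

/-- Conjugation by a unit vector is minus the reflection in its orthogonal hyperplane, and here that
reflection exchanges `e_a` and `e_b`. -/
theorem swapVector_mul_cliffordBasis {n : ℕ} {a b : Fin n} (h : a ≠ b) (i : Fin n) :
    swapVector n a b * cliffordBasis n i =
      -(cliffordBasis n (Equiv.swap a b i) * swapVector n a b) := by
  rw [swapVector, smul_mul_assoc, mul_smul_comm, ← smul_neg]
  congr 1
  rw [sub_mul, mul_sub]
  by_cases ha : i = a
  · subst ha
    rw [Equiv.swap_apply_left, cliffordBasis_mul_self, cliffordBasis_mul_self]
    abel
  by_cases hb : i = b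
  · subst hb
    rw [Equiv.swap_apply_right, cliffordBasis_mul_self, cliffordBasis_mul_self]
    abel
  rw [Equiv.swap_apply_of_ne_of_ne ha hb, cliffordBasis_anticomm (Ne.symm ha),
    cliffordBasis_anticomm (Ne.symm hb)]
  abel

theorem swapVector_anticomm {n : ℕ} {a b c d : Fin n} (hab : a ≠ b) (hca : c ≠ a) (hcb : c ≠ b)
    (hda : d ≠ a) (hdb : d ≠ b) :
    swapVector n a b * swapVector n c d = -(swapVector n c d * swapVector n a b) := by
  conv_lhs => rw [swapVector.eq_1 n c d]
  rw [mul_smul_comm, mul_sub, swapVector_mul_cliffordBasis hab, swapVector_mul_cliffordBasis hab,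
    Equiv.swap_apply_of_ne_of_ne hca hcb, Equiv.swap_apply_of_ne_of_ne hda hdb,
    swapVector.eq_1 n c d, smul_mul_assoc, sub_mul, ← smul_neg]
  congr 1
  abel

/-- `u` is a product of `k` (modulo `2`) unit vectors lying over the permutation `σ`. -/
structure IsPinLift (n k : ℕ) (σ : Equiv.Perm (Fin n)) (u : CliffordAlgebra (euclideanForm n)) :
    Prop where
  mem_lipschitz : u ∈ (lipschitzGroup (euclideanForm n)).toSubmonoid.map
    (Units.coeHom (CliffordAlgebra (euclideanForm n)))
  mem_evenOdd : u ∈ evenOdd (euclideanForm n) (k : ZMod 2)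
  sign : ((-1) ^ k : ℤˣ) = Equiv.Perm.sign σ
  reverse_mul : reverse u * u = 1
  mul_reverse : u * reverse u = 1
  mul_basis : ∀ i, u * cliffordBasis n i = (-1) ^ k * (cliffordBasis n (σ i) * u)

theorem IsPinLift.one (n : ℕ) : IsPinLift n 0 1 1 where
  mem_lipschitz := one_mem _
  mem_evenOdd := by simpa using SetLike.GradedOne.one_mem (A := evenOdd (euclideanForm n))
  sign := by simp
  reverse_mul := by simp
  mul_reverse := by simp
  mul_basis i := by simp

theorem IsPinLift.mul {n k l : ℕ} {σ τ : Equiv.Perm (Fin n)}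
    {u v : CliffordAlgebra (euclideanForm n)} (hu : IsPinLift n k σ u) (hv : IsPinLift n l τ v) :
    IsPinLift n (k + l) (σ * τ) (u * v) where
  mem_lipschitz := mul_mem hu.1 hv.1
  mem_evenOdd := by
    rw [Nat.cast_add]
    exact SetLike.GradedMul.mul_mem hu.2 hv.2
  sign := by rw [pow_add, hu.sign, hv.sign, map_mul]
  reverse_mul := by
    rw [reverse.map_mul, mul_assoc, ← mul_assoc (reverse u), hu.reverse_mul, one_mul,
      hv.reverse_mul]
  mul_reverse := by
    rw [reverse.map_mul, mul_assoc, ← mul_assoc v, hv.mul_reverse, one_mul, hu.mul_reverse]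
  mul_basis i := by
    have hcomm : Commute u ((-1) ^ l) := (Commute.neg_one_right u).pow_right l
    rw [mul_assoc, hv.mul_basis, ← mul_assoc, hcomm.eq, mul_assoc, ← mul_assoc u, hu.mul_basis,
      Equiv.Perm.mul_apply, add_comm, pow_add]
    simp only [mul_assoc]

theorem IsPinLift.swapVector {n : ℕ} {a b : Fin n} (h : a ≠ b) :
    IsPinLift n 1 (Equiv.swap a b) (swapVector n a b) where
  mem_lipschitz := by
    refine ⟨⟨_, _, swapVector_mul_self h, swapVector_mul_self h⟩, ?_, rfl⟩
    exact Subgroup.subset_closure (swapVector_mem_range_ι a b)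
  mem_evenOdd := by
    obtain ⟨v, hv⟩ := swapVector_mem_range_ι a b
    rw [← hv, Nat.cast_one]
    exact ι_mem_evenOdd_one _ v
  sign := by simp [Equiv.Perm.sign_swap h]
  reverse_mul := by
    obtain ⟨v, hv⟩ := swapVector_mem_range_ι a b
    rw [← hv, reverse_ι, hv, swapVector_mul_self h]
  mul_reverse := by
    obtain ⟨v, hv⟩ := swapVector_mem_range_ι a b
    rw [← hv, reverse_ι, hv, swapVector_mul_self h]
  mul_basis i := by rw [swapVector_mul_cliffordBasis h]; simp

/-- Multiplying a unit vector by its negative exhibits `-1` as a lift of the identity, hence as an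
element of `2Aₙ`. -/
theorem IsPinLift.neg_swapVector {n : ℕ} {a b : Fin n} (h : a ≠ b) :
    IsPinLift n 1 (Equiv.swap a b) (-_root_.swapVector n a b) := by
  have : -_root_.swapVector n a b = _root_.swapVector n b a := by
    rw [_root_.swapVector, _root_.swapVector, ← smul_neg, neg_sub]
  rw [this, Equiv.swap_comm]
  exact .swapVector h.symm

theorem exists_isPinLift {n : ℕ} (σ : Equiv.Perm (Fin n)) : ∃ k u, IsPinLift n k σ u := by
  induction σ using Equiv.Perm.swap_induction_on with
  | one => exact ⟨0, 1, .one n⟩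
  | swap_mul f x y hxy ih =>
    obtain ⟨k, u, hu⟩ := ih
    exact ⟨_, _, (IsPinLift.swapVector hxy).mul hu⟩

theorem IsPinLift.even {n k : ℕ} {σ : Equiv.Perm (Fin n)}
    {u : CliffordAlgebra (euclideanForm n)} (hu : IsPinLift n k σ u)
    (hσ : σ ∈ alternatingGroup (Fin n)) : Even k := by
  have h := hu.sign
  rw [Equiv.Perm.mem_alternatingGroup.1 hσ] at h
  by_contra hk
  rw [(Nat.not_even_iff_odd.1 hk).neg_one_pow] at h
  exact absurd h (by decide)

theorem IsPinLift.mem_spinGroup {n k : ℕ} {σ : Equiv.Perm (Fin n)}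
    {u : CliffordAlgebra (euclideanForm n)} (hu : IsPinLift n k σ u)
    (hσ : σ ∈ alternatingGroup (Fin n)) : u ∈ spinGroup (euclideanForm n) := by
  have hk : (k : ZMod 2) = 0 := (ZMod.natCast_eq_zero_iff_even).2 (hu.even hσ)
  have he := hu.mem_evenOdd
  rw [hk] at he
  have hstar : star u = reverse u := by rw [star_def, involute_eq_of_mem_even he]
  refine ⟨⟨hu.1, ?_⟩, he⟩
  rw [SetLike.mem_coe, Unitary.mem_iff, hstar]
  exact ⟨hu.reverse_mul, hu.mul_reverse⟩

/-- The element of `2Aₙ` given by a product of unit vectors lying over an even permutation. -/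
noncomputable def IsPinLift.toDoubleCover {n k : ℕ} {σ : Equiv.Perm (Fin n)}
    {u : CliffordAlgebra (euclideanForm n)} (hu : IsPinLift n k σ u)
    (hσ : σ ∈ alternatingGroup (Fin n)) : doubleCoverAlternating n :=
  ⟨⟨u, hu.mem_spinGroup hσ⟩, σ, hσ, fun i => by
    have h := hu.mul_basis i
    rw [(hu.even hσ).neg_one_pow, one_mul] at h
    change u * _ * _ = _
    rw [h, mul_assoc]
    have : u * (((⟨u, hu.mem_spinGroup hσ⟩ : spinGroup (euclideanForm n))⁻¹ :
        spinGroup (euclideanForm n)) : CliffordAlgebra (euclideanForm n)) = 1 :=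
      spinGroup.coe_mul_star_self ⟨u, hu.mem_spinGroup hσ⟩
    rw [this, mul_one]⟩

/-! ### The projection to `Aₙ` and its kernel -/

/-- The inclusion of `2Aₙ` into the Clifford algebra. -/
noncomputable def doubleCoverCoe (n : ℕ) :
    doubleCoverAlternating n →* CliffordAlgebra (euclideanForm n) :=
  (spinGroup (euclideanForm n)).subtype.comp (doubleCoverAlternating n).subtype

theorem doubleCoverCoe_injective (n : ℕ) : Function.Injective (doubleCoverCoe n) :=
  Subtype.val_injective.comp Subtype.val_injective

/-- `x ∈ 2Aₙ` lies over the permutation `σ`. -/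
def LiesOver {n : ℕ} (x : doubleCoverAlternating n) (σ : Equiv.Perm (Fin n)) : Prop :=
  ∀ i, doubleCoverCoe n x * cliffordBasis n i = cliffordBasis n (σ i) * doubleCoverCoe n x

theorem exists_liesOver {n : ℕ} (x : doubleCoverAlternating n) :
    ∃ σ ∈ alternatingGroup (Fin n), LiesOver x σ := by
  obtain ⟨u, σ, hσ, h⟩ := x
  refine ⟨σ, hσ, fun i => ?_⟩
  have hu : ((u⁻¹ : spinGroup (euclideanForm n)) : CliffordAlgebra (euclideanForm n)) * u = 1 :=
    spinGroup.coe_star_mul_self u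
  change (u : CliffordAlgebra (euclideanForm n)) * _ = _ * u
  rw [← h i, mul_assoc, hu, mul_one]

theorem LiesOver.one (n : ℕ) : LiesOver (1 : doubleCoverAlternating n) 1 := fun i => by simp

theorem LiesOver.mul {n : ℕ} {x y : doubleCoverAlternating n} {σ τ : Equiv.Perm (Fin n)}
    (hx : LiesOver x σ) (hy : LiesOver y τ) : LiesOver (x * y) (σ * τ) := fun i => by
  rw [map_mul, mul_assoc, hy i, ← mul_assoc, hx (τ i), mul_assoc, Equiv.Perm.mul_apply]

theorem LiesOver.inv {n : ℕ} {x : doubleCoverAlternating n} {σ : Equiv.Perm (Fin n)}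
    (hx : LiesOver x σ) : LiesOver x⁻¹ σ⁻¹ := fun i => by
  have h1 : doubleCoverCoe n x⁻¹ * doubleCoverCoe n x = 1 := by rw [← map_mul]; simp
  have h2 : doubleCoverCoe n x * doubleCoverCoe n x⁻¹ = 1 := by rw [← map_mul]; simp
  have h := hx (σ⁻¹ i)
  rw [← Equiv.Perm.mul_apply, mul_inv_cancel, Equiv.Perm.one_apply] at h
  calc _ = doubleCoverCoe n x⁻¹ * (cliffordBasis n i * doubleCoverCoe n x) *
        doubleCoverCoe n x⁻¹ := by rw [mul_assoc, mul_assoc, h2, mul_one]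
    _ = _ := by rw [← h, ← mul_assoc, h1, one_mul]

theorem IsPinLift.liesOver {n k : ℕ} {σ : Equiv.Perm (Fin n)}
    {u : CliffordAlgebra (euclideanForm n)} (hu : IsPinLift n k σ u)
    (hσ : σ ∈ alternatingGroup (Fin n)) : LiesOver (hu.toDoubleCover hσ) σ := fun i => by
  have h := hu.mul_basis i
  rwa [(hu.even hσ).neg_one_pow, one_mul] at h

theorem IsPinLift.coe_toDoubleCover {n k : ℕ} {σ : Equiv.Perm (Fin n)}
    {u : CliffordAlgebra (euclideanForm n)} (hu : IsPinLift n k σ u)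
    (hσ : σ ∈ alternatingGroup (Fin n)) : doubleCoverCoe n (hu.toDoubleCover hσ) = u := rfl

theorem one_ne_neg_one_clifford (n : ℕ) : (1 : CliffordAlgebra (euclideanForm n)) ≠ -1 := by
  intro h
  have h2 : algebraMap ℝ (CliffordAlgebra (euclideanForm n)) 1 = algebraMap ℝ _ (-1) := by
    simpa using h
  have := FaithfulSMul.algebraMap_injective ℝ (CliffordAlgebra (euclideanForm n)) h2
  norm_num at this

theorem cliffordBasis_injective (n : ℕ) : Function.Injective (cliffordBasis n) := by
  intro i j h
  by_contra hij
  have h1 := cliffordBasis_anticomm hij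
  rw [h, cliffordBasis_mul_self] at h1
  exact one_ne_neg_one_clifford n h1

theorem LiesOver.unique {n : ℕ} {x : doubleCoverAlternating n} {σ τ : Equiv.Perm (Fin n)}
    (hσ : LiesOver x σ) (hτ : LiesOver x τ) : σ = τ := by
  ext i : 1
  apply cliffordBasis_injective n
  have h2 : doubleCoverCoe n x * doubleCoverCoe n x⁻¹ = 1 := by rw [← map_mul]; simp
  have h := (hσ i).symm.trans (hτ i)
  have := congrArg (· * doubleCoverCoe n x⁻¹) h
  simpa [mul_assoc, h2] using this

/-- Such an element is even and commutes with every vector, so it is a scalar; unitarity makes the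
scalar square to `1`. -/
theorem LiesOver.eq_one_or_eq_neg_one {n : ℕ} {x : doubleCoverAlternating n}
    (hx : LiesOver x 1) : doubleCoverCoe n x = 1 ∨ doubleCoverCoe n x = -1 := by
  have hmem : doubleCoverCoe n x ∈ spinGroup (euclideanForm n) := x.1.2
  obtain ⟨r, hr⟩ := exists_eq_algebraMap_of_commute (spinGroup.involute_eq hmem) hx
  have hs := spinGroup.star_mul_self_of_mem hmem
  rw [hr, star_def, AlgHom.commutes, reverse.commutes, ← map_mul,
    ← map_one (algebraMap ℝ (CliffordAlgebra (euclideanForm n)))] at hs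
  have h1 : r * r = 1 := FaithfulSMul.algebraMap_injective ℝ _ hs
  rcases mul_self_eq_one_iff.1 h1 with rfl | rfl
  · left; simpa using hr
  · right; simpa using hr

theorem LiesOver.eq_or_eq_neg {n : ℕ} {x y : doubleCoverAlternating n} {σ : Equiv.Perm (Fin n)}
    (hx : LiesOver x σ) (hy : LiesOver y σ) :
    doubleCoverCoe n x = doubleCoverCoe n y ∨ doubleCoverCoe n x = -doubleCoverCoe n y := by
  have h := hx.mul hy.inv
  rw [mul_inv_cancel] at h
  have hxy : doubleCoverCoe n x = doubleCoverCoe n (x * y⁻¹) * doubleCoverCoe n y := by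
    rw [← map_mul, inv_mul_cancel_right]
  rcases h.eq_one_or_eq_neg_one with h | h
  · left; rw [hxy, h, one_mul]
  · right; rw [hxy, h, neg_one_mul]

theorem exists_liesOver_of_mem_alternatingGroup {n : ℕ} {σ : Equiv.Perm (Fin n)}
    (hσ : σ ∈ alternatingGroup (Fin n)) : ∃ x : doubleCoverAlternating n, LiesOver x σ := by
  obtain ⟨k, u, hu⟩ := exists_isPinLift σ
  exact ⟨_, hu.liesOver hσ⟩

theorem exists_doubleCoverCoe_eq_neg_one {n : ℕ} (hn : 2 ≤ n) :
    ∃ z : doubleCoverAlternating n, doubleCoverCoe n z = -1 := by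
  have h : (⟨0, by omega⟩ : Fin n) ≠ ⟨1, by omega⟩ := by simp
  refine ⟨((IsPinLift.swapVector h).mul (IsPinLift.neg_swapVector h)).toDoubleCover
    (by simp), ?_⟩
  rw [IsPinLift.coe_toDoubleCover, mul_neg, swapVector_mul_self h]

/-! ### Standard products of disjoint transpositions and their lifts -/

section PairProducts

variable (n : ℕ) [NeZero n]

/-- The product of the transpositions `(0 1), (2 3), …, (2m-2 2m-1)`. -/
def pairPerm : ℕ → Equiv.Perm (Fin n)
  | 0 => 1
  | m + 1 => pairPerm m * Equiv.swap (Fin.ofNat n (2 * m)) (Fin.ofNat n (2 * m + 1))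

/-- The unit vector over the transposition `(2m 2m+1)`. -/
noncomputable def pairVector (m : ℕ) : CliffordAlgebra (euclideanForm n) :=
  swapVector n (Fin.ofNat n (2 * m)) (Fin.ofNat n (2 * m + 1))

/-- The product of the unit vectors over the transpositions `(0 1), (2 3), …, (2m-2 2m-1)`. -/
noncomputable def pairProd : ℕ → CliffordAlgebra (euclideanForm n)
  | 0 => 1
  | m + 1 => pairProd m * pairVector n m

variable {n}

theorem finOfNat_ne {a b : ℕ} (ha : a < n) (hb : b < n) (h : a ≠ b) :
    Fin.ofNat n a ≠ Fin.ofNat n b := by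
  rw [Ne, Fin.ext_iff]
  simpa [Fin.ofNat, Nat.mod_eq_of_lt ha, Nat.mod_eq_of_lt hb] using h

theorem pairPerm_apply_of_le {m : ℕ} (hm : 2 * m ≤ n) {a : ℕ} (ha : a < n) (hma : 2 * m ≤ a) :
    pairPerm n m (Fin.ofNat n a) = Fin.ofNat n a := by
  induction m with
  | zero => rfl
  | succ m ih =>
    rw [pairPerm, Equiv.Perm.mul_apply, Equiv.swap_apply_of_ne_of_ne
      (finOfNat_ne ha (by omega) (by omega)) (finOfNat_ne ha (by omega) (by omega)),
      ih (by omega) (by omega)]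

theorem cycleType_pairPerm {m : ℕ} (hm : 2 * m ≤ n) :
    (pairPerm n m).cycleType = Multiset.replicate m 2 := by
  induction m with
  | zero => simp [pairPerm]
  | succ m ih =>
    have hne : Fin.ofNat n (2 * m) ≠ Fin.ofNat n (2 * m + 1) :=
      finOfNat_ne (by omega) (by omega) (by omega)
    have hd : (pairPerm n m).Disjoint
        (Equiv.swap (Fin.ofNat n (2 * m)) (Fin.ofNat n (2 * m + 1))) := by
      intro i
      by_cases h1 : i = Fin.ofNat n (2 * m)
      · left; rw [h1]; exact pairPerm_apply_of_le (by omega) (by omega) (by omega)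
      by_cases h2 : i = Fin.ofNat n (2 * m + 1)
      · left; rw [h2]; exact pairPerm_apply_of_le (by omega) (by omega) (by omega)
      · right; exact Equiv.swap_apply_of_ne_of_ne h1 h2
    rw [pairPerm, hd.cycleType_mul, ih (by omega), (Equiv.Perm.isCycle_swap hne).cycleType,
      Equiv.Perm.card_support_swap hne, Multiset.replicate_succ, add_comm,
      Multiset.singleton_add]

/-- This supplies an odd permutation in the centralizer, used to correct the parity of a conjugating
element. -/
theorem commute_swap_pairPerm {m : ℕ} (hm : 2 * m ≤ n) :
    Commute (Equiv.swap (Fin.ofNat n 0) (Fin.ofNat n 1)) (pairPerm n m) := by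
  induction m with
  | zero => exact Commute.one_right _
  | succ m ih =>
    refine (ih (by omega)).mul_right ?_
    rcases Nat.eq_zero_or_pos m with rfl | hpos
    · exact Commute.refl _
    refine Equiv.Perm.Disjoint.commute fun i => ?_
    by_cases h1 : i = Fin.ofNat n (2 * m)
    · left
      rw [h1]
      exact Equiv.swap_apply_of_ne_of_ne (finOfNat_ne (by omega) (by omega) (by omega))
        (finOfNat_ne (by omega) (by omega) (by omega))
    by_cases h2 : i = Fin.ofNat n (2 * m + 1)
    · left
      rw [h2]
      exact Equiv.swap_apply_of_ne_of_ne (finOfNat_ne (by omega) (by omega) (by omega))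
        (finOfNat_ne (by omega) (by omega) (by omega))
    · right; exact Equiv.swap_apply_of_ne_of_ne h1 h2

theorem isPinLift_pairProd {m : ℕ} (hm : 2 * m ≤ n) :
    IsPinLift n m (pairPerm n m) (pairProd n m) := by
  induction m with
  | zero => exact .one n
  | succ m ih =>
    exact (ih (by omega)).mul (.swapVector (finOfNat_ne (by omega) (by omega) (by omega)))

theorem pairVector_mul_pairProd {k l : ℕ} (hkl : k ≤ l) (hl : 2 * l + 2 ≤ n) :
    pairVector n l * pairProd n k = (-1) ^ k * (pairProd n k * pairVector n l) := by
  induction k with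
  | zero => simp [pairProd]
  | succ k ih =>
    have h : pairVector n l * pairVector n k = -(pairVector n k * pairVector n l) := by
      apply swapVector_anticomm <;> apply finOfNat_ne <;> omega
    rw [pairProd, ← mul_assoc, ih (by omega), mul_assoc, mul_assoc, h, pow_succ]
    simp [mul_assoc]

/-- The longer product extends the shorter one, and each extra vector anticommutes with all `k`
factors of the latter, giving the sign `(-1) ^ k = 1`. -/
theorem commute_pairProd {k l : ℕ} (hk : Even k) (hkl : k ≤ l) (hl : 2 * l ≤ n) :
    Commute (pairProd n k) (pairProd n l) := by
  induction l, hkl using Nat.le_induction with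
  | base => exact Commute.refl _
  | succ l hkl ih =>
    refine (ih (by omega)).mul_right ?_
    have h := pairVector_mul_pairProd hkl (by omega : 2 * l + 2 ≤ n)
    rw [hk.neg_one_pow, one_mul] at h
    exact h.symm

/-- Moving the last vector past the `m` earlier ones contributes `(-1) ^ m`; Pascal's rule adds up
the exponents. -/
theorem pairProd_mul_self {m : ℕ} (hm : 2 * m ≤ n) :
    pairProd n m * pairProd n m = (-1) ^ m.choose 2 := by
  induction m with
  | zero => simp [pairProd]
  | succ m ih =>
    have hc : Commute (pairProd n m) ((-1) ^ m) := (Commute.neg_one_right _).pow_right m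
    have ht : pairVector n m * pairVector n m = 1 :=
      swapVector_mul_self (finOfNat_ne (by omega) (by omega) (by omega))
    rw [pairProd, mul_assoc, ← mul_assoc (pairVector n m), pairVector_mul_pairProd le_rfl
      (by omega), mul_assoc, mul_assoc, ht, mul_one, ← mul_assoc, hc.eq, mul_assoc, ih (by omega),
      ← pow_add, Nat.choose_succ_succ' m 1, Nat.choose_one_right]

end PairProducts

/-! ### Parity of `m.choose 2`, conjugation in `Aₙ`, and the broad subgroup -/

theorem even_choose_two_four_mul (k : ℕ) : Even ((4 * k).choose 2) := by
  rw [Nat.choose_two_right, show 4 * k * (4 * k - 1) = 2 * (2 * (k * (4 * k - 1))) by ring,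
    Nat.mul_div_cancel_left _ two_pos]
  exact even_two_mul _

/-- For `m = 2j` the binomial coefficient is `j(2j - 1)`, whose second factor is odd when `j > 0`,
so `j` is even. -/
theorem exists_eq_four_mul {m : ℕ} (hm : Even m) (hc : Even (m.choose 2)) : ∃ k, m = 4 * k := by
  obtain ⟨j, rfl⟩ := hm
  rw [← two_mul, Nat.choose_two_right, mul_assoc, Nat.mul_div_cancel_left _ two_pos] at hc
  rcases Nat.even_mul.1 hc with ⟨i, rfl⟩ | h
  · exact ⟨i, by ring⟩
  -- At `j = 0` truncated subtraction makes `2 * j - 1` even, so this case is separate.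
  · rcases Nat.eq_zero_or_pos j with rfl | hj
    · exact ⟨0, rfl⟩
    · obtain ⟨i, hi⟩ := h
      omega

theorem exists_even_conj_eq_pairPerm {n : ℕ} [NeZero n] (hn : 2 ≤ n) {σ : Equiv.Perm (Fin n)}
    (hσ : σ ^ 2 = 1) :
    ∃ m, 2 * m ≤ n ∧ ∃ τ ∈ alternatingGroup (Fin n), τ * σ * τ⁻¹ = pairPerm n m := by
  have hc := Equiv.Perm.cycleType_of_pow_prime_eq_one hσ
  set m := σ.cycleType.card with hm
  have h2m : 2 * m ≤ n := by
    have h := σ.sum_cycleType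
    rw [hc, Multiset.sum_replicate, smul_eq_mul] at h
    have h' := σ.support.card_le_univ
    rw [Fintype.card_fin] at h'
    omega
  have hconj : IsConj σ (pairPerm n m) :=
    Equiv.Perm.isConj_iff_cycleType_eq.2 (hc.trans (cycleType_pairPerm h2m).symm)
  obtain ⟨τ, hτ⟩ := isConj_iff.1 hconj
  refine ⟨m, h2m, ?_⟩
  rcases Int.units_eq_one_or (Equiv.Perm.sign τ) with h | h
  · exact ⟨τ, Equiv.Perm.mem_alternatingGroup.2 h, hτ⟩
  -- An odd conjugator becomes even after composing with the transposition `(0 1)`, which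
  -- centralizes the target.
  · refine ⟨Equiv.swap (Fin.ofNat n 0) (Fin.ofNat n 1) * τ, ?_, ?_⟩
    · rw [Equiv.Perm.mem_alternatingGroup, map_mul, h, Equiv.Perm.sign_swap
        (finOfNat_ne (by omega) (by omega) (by omega))]
      rfl
    · rw [mul_inv_rev, ← (commute_swap_pairPerm h2m).mul_inv_cancel, ← hτ]
      simp only [mul_assoc]

theorem isElementaryAbelianTwo_closure {G : Type*} [Group G] {S : Set G}
    (hcomm : ∀ x ∈ S, ∀ y ∈ S, x * y = y * x) (hsq : ∀ x ∈ S, x ^ 2 = 1) :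
    IsElementaryAbelianTwo (Subgroup.closure S) := by
  have hc : ∀ x ∈ Subgroup.closure S, ∀ y ∈ Subgroup.closure S, x * y = y * x := by
    have := Subgroup.isMulCommutative_closure hcomm
    intro x hx y hy
    exact setLike_mul_comm hx hy
  refine ⟨hc, fun x hx => ?_⟩
  induction hx using Subgroup.closure_induction with
  | mem x hx => exact hsq x hx
  | one => exact one_pow 2
  | mul x y hx hy ihx ihy => rw [(show Commute x y from hc x hx y hy).mul_pow, ihx, ihy, one_mul]
  | inv x _ ih => rw [inv_pow, ih, inv_one]

theorem mainTheorem9 (n : ℕ) (hn : 5 ≤ n) :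
    ∃ E : Subgroup (doubleCoverAlternating n), IsBroadSubgroup E := by
  have : NeZero n := ⟨by omega⟩
  have hinj := doubleCoverCoe_injective n
  -- The bound `8 * k ≤ n` says that `4k` disjoint transpositions fit into `n` points.
  set S : Set (doubleCoverAlternating n) :=
    {x | doubleCoverCoe n x = -1 ∨ ∃ k, 8 * k ≤ n ∧ doubleCoverCoe n x = pairProd n (4 * k)}
    with hS
  refine ⟨Subgroup.closure S, isElementaryAbelianTwo_closure ?_ ?_, fun x hx => ?_⟩
  · intro x hx y hy
    apply hinj
    rw [map_mul, map_mul]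
    rcases hx with hx | ⟨k, hk, hx⟩
    · simp [hx]
    rcases hy with hy | ⟨l, hl, hy⟩
    · simp [hy]
    rw [hx, hy]
    rcases le_total k l with h | h
    · exact commute_pairProd (Nat.even_mul.2 (.inl (by decide))) (by omega) (by omega)
    · exact (commute_pairProd (Nat.even_mul.2 (.inl (by decide))) (by omega) (by omega)).symm
  · intro x hx
    apply hinj
    rw [map_pow, map_one]
    rcases hx with hx | ⟨k, hk, hx⟩
    · simp [hx]
    · rw [hx, pow_two, pairProd_mul_self (by omega), (even_choose_two_four_mul k).neg_one_pow]
  · have hx2 : x ^ 2 = 1 := hx ▸ pow_orderOf_eq_one x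
    obtain ⟨σ, hσ, hxσ⟩ := exists_liesOver x
    have hσ2 : σ ^ 2 = 1 := by
      have h := hxσ.mul hxσ
      rw [← pow_two, ← pow_two, hx2] at h
      exact h.unique (.one n)
    obtain ⟨m, hm, τ, hτ, hconj⟩ := exists_even_conj_eq_pairPerm (by omega) hσ2
    obtain ⟨g, hg⟩ := exists_liesOver_of_mem_alternatingGroup hτ
    have hy := (hg.mul hxσ).mul hg.inv
    rw [hconj] at hy
    have halt : pairPerm n m ∈ alternatingGroup (Fin n) :=
      hconj ▸ mul_mem (mul_mem hτ hσ) (inv_mem hτ)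
    have hlift := isPinLift_pairProd hm
    have hy2 : doubleCoverCoe n (g * x * g⁻¹) * doubleCoverCoe n (g * x * g⁻¹) = 1 := by
      rw [← map_mul, ← pow_two, conj_pow, hx2]
      simp
    have hcase := hy.eq_or_eq_neg (hlift.liesOver halt)
    rw [hlift.coe_toDoubleCover] at hcase
    -- The unknown sign disappears on squaring, so the standard lift inherits the square of the
    -- involution.
    have hw : pairProd n m * pairProd n m = 1 := by
      rcases hcase with h | h
      · rwa [h] at hy2
      · rwa [h, neg_mul_neg] at hy2
    have hchoose : Even (m.choose 2) := by
      by_contra hodd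
      rw [pairProd_mul_self hm, (Nat.not_even_iff_odd.1 hodd).neg_one_pow] at hw
      exact one_ne_neg_one_clifford n hw.symm
    obtain ⟨k, rfl⟩ := exists_eq_four_mul (hlift.even halt) hchoose
    have hW : hlift.toDoubleCover halt ∈ Subgroup.closure S :=
      Subgroup.subset_closure (.inr ⟨k, by omega, rfl⟩)
    refine ⟨g * x * g⁻¹, ?_, isConj_iff.2 ⟨g, rfl⟩⟩
    -- Either sign stays in the subgroup, since `-1` is one of its generators.
    rcases hcase with h | h
    · rwa [hinj (h.trans (hlift.coe_toDoubleCover halt).symm)]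
    · obtain ⟨z, hz⟩ := exists_doubleCoverCoe_eq_neg_one (by omega : 2 ≤ n)
      have : g * x * g⁻¹ = z * hlift.toDoubleCover halt := by
        apply hinj
        rw [h, map_mul, hz, hlift.coe_toDoubleCover, neg_one_mul]
      rw [this]
      exact mul_mem (Subgroup.subset_closure (.inl hz)) hW
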